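/- Let $E$ be a finite set and, for $i\in E$, let $F^i:\mathbb{R}^d\to\mathbb{R}^d$ be a $C^\infty$ vector field; assume $\sup_{x,i}\|F^i(x)\|<\infty$, and let $\Phi^i=(\Phi^i_t)$ be the flow of $F^i$. Let $M\subset\mathbb{R}^d$ be a compact set with $\Phi^i_t(M)\subset M$ for all $i\in E$ and $t\ge 0$. For $i,j\in E$ let $x\mapsto\lambda(x,i,j)$ be a continuous function on $M$, with $\lambda(x,i,j)\ge 0$ for $i\ne j$ and $\lambda(x,i,i)=0$, such that for every $x\in M$ the matrix $(\lambda(x,i,j))_{i,j}$ is irreducible (every index can be reached from every other one along positive entries). Fix $\lambda>0$ with $\sum_{j}\lambda(x,i,j)<\lambda$ for all $x\in M$, $i\in E$, and put $Q(x,i,j)=\lambda(x,i,j)/\lambda$ for $i\ne j$ and $Q(x,i,i)=1-\sum_{j\ne i}Q(x,i,j)$. Let $\tilde Z=(\tilde X_n,\tilde Y_n)_{n\ge 0}$ be the Markov chain on $M\times E$ for which, given $(\tilde X_n,\tilde Y_n)=(x,i)$, one has $\tilde X_{n+1}=\Phi^i_U(x)$ with $U$ exponential of parameter $\lambda$ and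 $\tilde Y_{n+1}=j$ with conditional probability $Q(\tilde X_{n+1},i,j)$; that is, its transition operator is $$\tilde P g(x,i)=\int_0^\infty \lambda e^{-\lambda t}\sum_{j\in E}Q(\Phi^i_t(x),i,j)\,g(\Phi^i_t(x),j)\,dt .$$ Let $\tilde{\mathcal P}_{inv}$ be the set of Borel probability measures $\mu$ on $M\times E$ that are invariant for $\tilde Z$, i.e. $\int\tilde P g\,d\mu=\int g\,d\mu$ for every continuous $g:M\times E\to\mathbb{R}$. The chain is called stable if $\tilde{\mathcal P}_{inv}$ has exactly one element. For $x\in M$ let $\gamma^+(x)$ be the set of all points $\Phi^{i_{n-1}}_{u_n}\circ\cdots\circ\Phi^{i_0}_{u_1}(x)$ with $n\ge 1$, $i_0,\dots,i_{n-1}\in E$ and $u_1,\dots,u_n\ge 0$, and let $$\Gamma=\Bigl\{p\in M : p\in\overline{\gamma^+(x)}\ \text{ for all } x\in M\Bigr\}$$ be the accessible set. Then: (i) If $\Gamma\neq\emptyset$, then $\Gamma\times E\subset\operatorname{supp}(\mu)$ for all $\mu\in\tilde{\mathcal P}_{inv}$, and there exists $\mu\in\tilde{\mathcal P}_{inv}$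 with $\operatorname{supp}(\mu)=\Gamma\times E$. (ii) If $\Gamma$ has nonempty interior (in $\mathbb{R}^d$), then $\operatorname{supp}(\mu)=\Gamma\times E$ for all $\mu\in\tilde{\mathcal P}_{inv}$. (iii) If $\tilde Z$ is stable, with invariant probability $\pi$, then $\operatorname{supp}(\pi)=\Gamma\times E$. -/

import Mathlib

open MeasureTheory Set Topology
open scoped NNReal

noncomputable section

namespace SwitchedPDMP

open Classical in
/-- The flow of a vector field `V` on `ℝᵈ`: `flow V t x` is the value at time `t` of the solution
of the Cauchy problem `γ' = V(γ)`, `γ(0) = x` on the whole line. Such a solution exists and is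
unique when `V` is smooth and bounded (see `flow_spec` for existence), so that the default value
is irrelevant below. -/
def flow {d : ℕ} (V : EuclideanSpace ℝ (Fin d) → EuclideanSpace ℝ (Fin d)) (t : ℝ)
    (x : EuclideanSpace ℝ (Fin d)) : EuclideanSpace ℝ (Fin d) :=
  if h : ∃ γ : ℝ → EuclideanSpace ℝ (Fin d), γ 0 = x ∧ ∀ s, HasDerivAt γ (V (γ s)) s
  then h.choose t else x

/-- For a smooth bounded vector field the Cauchy problem has a solution on the whole line. -/
theorem flow_spec {d : ℕ} (V : EuclideanSpace ℝ (Fin d) → EuclideanSpace ℝ (Fin d))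
    (hV : ContDiff ℝ (⊤ : ℕ∞) V) {C : ℝ} (hC : ∀ x, ‖V x‖ ≤ C) (x : EuclideanSpace ℝ (Fin d)) :
    flow V 0 x = x ∧ ∀ t, HasDerivAt (fun s => flow V s x) (V (flow V t x)) t := by
  have hV1 : ContDiff ℝ 1 V := hV.of_le (by exact_mod_cast le_top)
  have key : ∃ γ : ℝ → EuclideanSpace ℝ (Fin d), γ 0 = x ∧ ∀ s, HasDerivAt γ (V (γ s)) s := by
    have hC0 : 0 ≤ C := (norm_nonneg _).trans (hC 0)
    obtain ⟨γ, h0, h⟩ := exists_isMIntegralCurve_of_isMIntegralCurveOn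
      (I := modelWithCornersSelf ℝ (EuclideanSpace ℝ (Fin d)))
      (M := EuclideanSpace ℝ (Fin d)) (v := V)
      (contMDiff_vectorSpace_iff_contDiff.2 hV1) one_pos (fun y => by
        obtain ⟨K, hK⟩ := hV1.contDiffOn.exists_lipschitzOnWith one_ne_zero
          (convex_closedBall y C) (isCompact_closedBall y C)
        have hpl : IsPicardLindelof (fun _ => V) (tmin := -1) (tmax := 1)
            ⟨0, by norm_num⟩ y ⟨C, hC0⟩ 0 ⟨C, hC0⟩ K :=
          IsPicardLindelof.of_time_independent (fun z _ => hC z) hK (by simp)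
        obtain ⟨α, h0, hα⟩ := hpl.exists_eq_forall_mem_Icc_hasDerivWithinAt₀
        refine ⟨α, h0, fun t ht => ?_⟩
        exact ((hα t (Ioo_subset_Icc_self ht)).mono Ioo_subset_Icc_self
          ).hasFDerivWithinAt.hasMFDerivWithinAt) x
    refine ⟨γ, h0, fun s => ?_⟩
    have h2 : HasFDerivAt γ ((1 : ℝ →L[ℝ] ℝ).smulRight (V (γ s))) s := (h s).hasFDerivAt
    simpa using h2.hasDerivAt
  have e : (fun s => flow V s x) = key.choose := by
    funext s
    simp only [flow, dif_pos key]
  have hs := key.choose_spec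
  rw [← e] at hs
  exact hs

/-- The data of the switched process on `M × E`. -/
structure Model (d : ℕ) (E : Type*) [Fintype E] where
  /-- the vector fields `Fⁱ` -/
  F : E → EuclideanSpace ℝ (Fin d) → EuclideanSpace ℝ (Fin d)
  smooth : ∀ i, ContDiff ℝ (⊤ : ℕ∞) (F i)
  bounded : ∃ C : ℝ, ∀ i x, ‖F i x‖ ≤ C
  /-- the compact set `M` -/
  M : Set (EuclideanSpace ℝ (Fin d))
  isCompact_M : IsCompact M
  flow_mem : ∀ i (t : ℝ), 0 ≤ t → ∀ x ∈ M, flow (F i) t x ∈ M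
  /-- the jump rates `λ(x,i,j)` -/
  rate : M → E → E → ℝ
  rate_continuous : ∀ i j, Continuous fun x => rate x i j
  rate_nonneg : ∀ x i j, i ≠ j → 0 ≤ rate x i j
  rate_self : ∀ x i, rate x i i = 0
  /-- irreducibility of the matrix `(λ(x,i,j))` for each `x` -/
  rate_irreducible : ∀ x i j, Relation.ReflTransGen (fun a b => 0 < rate x a b) i j
  /-- the intensity `λ` of the Poisson clock, larger than every total jump rate -/
  lam : ℝ
  lam_pos : 0 < lam
  sum_rate_lt : ∀ x i, ∑ j, rate x i j < lam

namespace Model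

variable {d : ℕ} {E : Type*} [Fintype E] (D : Model d E)

/-- The semiflow `Φⁱₜ : M → M`, `t ≥ 0`. -/
def Phi (i : E) (t : ℝ≥0) (x : D.M) : D.M :=
  ⟨flow (D.F i) t x, D.flow_mem i t t.2 x x.2⟩

open Classical in
/-- The jump matrix: `Q(x,i,j) = λ(x,i,j)/λ` for `i ≠ j`, `Q(x,i,i) = 1 - ∑_{j ≠ i} Q(x,i,j)`. -/
def Q (x : D.M) (i j : E) : ℝ :=
  if i = j then 1 - ∑ k ∈ Finset.univ.erase i, D.rate x i k / D.lam
  else D.rate x i j / D.lam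

/-- The operator `Q g(x,i) = ∑ⱼ Q(x,i,j) g(x,j)`. -/
def jumpOp (g : D.M × E → ℝ) (z : D.M × E) : ℝ := ∑ j, D.Q z.1 z.2 j * g (z.1, j)

/-- The operator `K_t g(x,i) = g(Φⁱₜ(x),i)`. -/
def flowOp (t : ℝ≥0) (g : D.M × E → ℝ) (z : D.M × E) : ℝ := g (D.Phi z.2 t z.1, z.2)

/-- The transition operator of the embedded chain `Z̃`,
`P̃ g(x,i) = 𝔼[g(Z̃₁) | Z̃₀ = (x,i)] = ∫₀^∞ K_t Q g(x,i) λ e^{-λt} dt`: from `(x,i)` the chain follows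
the flow `Φⁱ` during an exponential time of parameter `λ`, and then draws the new index
according to the row `i` of `Q` at the point that has been reached. -/
def transitionOp (g : D.M × E → ℝ) (z : D.M × E) : ℝ :=
  ∫ t in Ioi (0 : ℝ), D.flowOp t.toNNReal (D.jumpOp g) z * (D.lam * Real.exp (-D.lam * t))

/-- Invariant probability measures of `Z̃`: `μ P̃ = μ`, where `μ P̃` is defined by duality
against continuous functions on the compact space `M × E`. -/
def IsInvariant [TopologicalSpace E] [MeasurableSpace E] (μ : Measure (D.M × E)) : Prop :=
  IsProbabilityMeasure μ ∧
    ∀ g : C(D.M × E, ℝ), ∫ z, D.transitionOp g z ∂μ = ∫ z, g z ∂μ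

/-- The chain `Z̃` is stable if it has a unique invariant probability measure. -/
def IsStable [TopologicalSpace E] [MeasurableSpace E] : Prop :=
  ∃! μ : Measure (D.M × E), D.IsInvariant μ

/-- The composite flow `Φ^{i_{n-1}}_{u_n} ∘ ⋯ ∘ Φ^{i_0}_{u_1}` encoded by the list
`[(i_0,u_1), …, (i_{n-1},u_n)]`. -/
def composite (l : List (E × ℝ≥0)) (x : D.M) : D.M :=
  l.foldl (fun y p => D.Phi p.1 p.2 y) x

/-- The positive orbit `γ⁺(x)`, as a subset of `ℝᵈ`. -/
def orbit (x : D.M) : Set (EuclideanSpace ℝ (Fin d)) :=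
  {y | ∃ l : List (E × ℝ≥0), l ≠ [] ∧ (D.composite l x : EuclideanSpace ℝ (Fin d)) = y}

/-- The accessible set `Γ ⊆ M`, the points of `M` that lie in the closure of `γ⁺(x)` for every
`x ∈ M`. -/
def accessible : Set (EuclideanSpace ℝ (Fin d)) :=
  D.M ∩ ⋂ x : D.M, closure (D.orbit x)

/-- The set `Γ × E` as a subset of the state space `M × E`. -/
def accessibleProd : Set (D.M × E) := {z | (z.1 : EuclideanSpace ℝ (Fin d)) ∈ D.accessible}

end Model

end SwitchedPDMP

end

open Filter

/-! Two facts about closed positively invariant sets `K ⊆ M` carry the proof. First, `Γ` lies in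
every nonempty such `K`, since it lies in the closure of any orbit started in `K`. Second, each
nonempty such `K` gives rise to an invariant probability supported in `K × E`: Krylov–Bogoliubov
averages started in `K × E` never leave it (`exists_isInvariant_support_subset`).

The support of an invariant measure is stable under the transitions of the chain. Irreducibility,
with flow time 0, makes it a union of full fibres `{x} × E`; since `Q(x,i,i) > 0`, its slices are
positively invariant. These slices are closed, so the first fact gives `Γ × E ⊆ supp μ`
(`accessibleProd_subset_support`).

For the other inclusion, (i) takes `K = Γ` in the second fact. In (iii), uniqueness identifies `π`
with a measure supported over the orbit closure of `y`, for every `y`, and these closures intersect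
in `Γ`. In (ii), restricting `μ` to `Γ × E`, hence also to its complement, preserves invariance; a
nonzero restriction to the complement would have `Γ × E` in its support, yet it does not charge the
interior of `Γ`. -/

theorem eq_zero_of_integral_eq_zero_of_mem_support {X : Type*} [TopologicalSpace X]
    [MeasurableSpace X] {μ : Measure X} {g : X → ℝ} (hg : Continuous g) (h0 : ∀ x, 0 ≤ g x)
    (hi : Integrable g μ) (h : ∫ x, g x ∂μ = 0) {x : X} (hx : x ∈ μ.support) : g x = 0 := by
  by_contra hne
  have hpos : 0 < g x := lt_of_le_of_ne (h0 x) (Ne.symm hne)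
  have hU : {y | 0 < g y} ∈ 𝓝 x := (isOpen_lt continuous_const hg).mem_nhds hpos
  have h1 := (Measure.mem_support_iff_forall x).1 hx _ hU
  have h2 : g =ᵐ[μ] 0 := (integral_eq_zero_iff_of_nonneg h0 hi).1 h
  refine h1.ne' (measure_mono_null (fun y hy => ?_) h2)
  exact fun hy' => (ne_of_gt hy) hy'

/-- The endpoint `t = a` matters: flow time 0 must count as possible, so that jumps without
displacement can be used. -/
theorem mem_support_restrict_Ioi {a t : ℝ} (ht : a ≤ t) :
    t ∈ (volume.restrict (Ioi a) : Measure ℝ).support := by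
  rw [Measure.mem_support_iff_forall]
  intro U hU
  obtain ⟨V, hVU, hV, htV⟩ := mem_nhds_iff.1 hU
  have hcl : t ∈ closure (Ioi a) := by rw [closure_Ioi]; exact ht
  have hne : (V ∩ Ioi a).Nonempty := mem_closure_iff.1 hcl V hV htV
  have hpos : 0 < volume (V ∩ Ioi a) := (hV.inter isOpen_Ioi).measure_pos volume hne
  rw [← Measure.restrict_apply hV.measurableSet] at hpos
  exact hpos.trans_le (measure_mono hVU)

theorem exists_continuousMap_eqOn_zero_of_notMem {X : Type*} [TopologicalSpace X] [NormalSpace X]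
    [T1Space X] {K : Set X} (hK : IsClosed K) {x : X} (hx : x ∉ K) :
    ∃ g : C(X, ℝ), (∀ y ∈ K, g y = 0) ∧ g x = 1 ∧ ∀ y, 0 ≤ g y := by
  obtain ⟨g, h0, h1, h2⟩ := exists_continuous_zero_one_of_isClosed hK (isClosed_singleton (x := x))
    (Set.disjoint_singleton_right.2 hx)
  exact ⟨g, fun y hy => h0 hy, h1 rfl, fun y => (h2 y).1⟩

/-- **Krylov–Bogoliubov**: a positive unital operator on `C(X, ℝ)`, with `X` compact, has an
invariant probability measure that does not charge the functions vanishing along the iterates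
started from a given point. -/
theorem exists_invariant_probabilityMeasure {X : Type*} [TopologicalSpace X] [CompactSpace X]
    [T2Space X] [MeasurableSpace X] [BorelSpace X] (P : C(X, ℝ) →ₗ[ℝ] C(X, ℝ))
    (hP : ∀ g, 0 ≤ g → 0 ≤ P g) (hP1 : P 1 = 1) (z : X) :
    ∃ μ : Measure X, IsProbabilityMeasure μ ∧ (∀ g : C(X, ℝ), ∫ x, P g x ∂μ = ∫ x, g x ∂μ) ∧
      ∀ g : C(X, ℝ), (∀ n : ℕ, (P ^ n) g z = 0) → ∫ x, g x ∂μ = 0 := by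
  have hpow : ∀ (n : ℕ) g, 0 ≤ g → 0 ≤ (P ^ n) g := by
    intro n
    induction n with
    | zero => intro g hg; simpa using hg
    | succ n ih => intro g hg; rw [pow_succ']; exact hP _ (ih g hg)
  have hpow1 : ∀ n : ℕ, (P ^ n) 1 = 1 := by
    intro n
    induction n with
    | zero => simp
    | succ n ih => rw [pow_succ', Module.End.mul_apply, ih, hP1]
  have hbound : ∀ (n : ℕ) (g : C(X, ℝ)), |(P ^ n) g z| ≤ ‖g‖ := by
    intro n g
    have key : ∀ h : C(X, ℝ), ‖h‖ ≤ ‖g‖ → (P ^ n) h z ≤ ‖g‖ := by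
      intro h hh
      have h1 : 0 ≤ (P ^ n) (‖g‖ • (1 : C(X, ℝ)) - h) := by
        refine hpow n _ fun x => ?_
        have := (le_abs_self _).trans ((h.norm_coe_le_norm x).trans hh)
        simpa using this
      have h2 := h1 z
      rw [map_sub, map_smul, hpow1] at h2
      simpa using h2
    refine abs_le.2 ⟨?_, key g le_rfl⟩
    have := key (-g) (by simp)
    rw [map_neg] at this
    simp only [ContinuousMap.neg_apply] at this
    linarith
  -- Cesàro averages along the iterates from `z`, with `n + 1` terms so that the denominator never
  -- vanishes.
  let a : C(X, ℝ) → ℕ → ℝ := fun g n => (n + 1 : ℝ)⁻¹ * ∑ k ∈ Finset.range (n + 1), (P ^ k) g z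
  have ha : ∀ g n, |a g n| ≤ ‖g‖ := by
    intro g n
    have hn : (0 : ℝ) < n + 1 := by positivity
    have h1 : |∑ k ∈ Finset.range (n + 1), (P ^ k) g z| ≤ (n + 1) * ‖g‖ := by
      refine (Finset.abs_sum_le_sum_abs _ _).trans ?_
      refine (Finset.sum_le_sum fun k _ => hbound k g).trans ?_
      simp
    simp only [a, abs_mul, abs_inv, abs_of_pos hn]
    rw [inv_mul_le_iff₀ hn]
    exact h1
  -- A free ultrafilter gives limits for all `g` at once, so that linearity and positivity pass to
  -- the limit without extracting subsequences.
  let U : Ultrafilter ℕ := hyperfilter ℕ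
  have hU : (U : Filter ℕ) ≤ atTop := by
    rw [← Nat.cofinite_eq_atTop]; exact hyperfilter_le_cofinite
  have hlim : ∀ g, ∃ L, Tendsto (a g) U (𝓝 L) := by
    intro g
    obtain ⟨L, -, hL⟩ := (isCompact_Icc (a := -‖g‖) (b := ‖g‖)).ultrafilter_le_nhds (U.map (a g))
      (tendsto_principal.2 (Eventually.of_forall fun n => abs_le.1 (ha g n)))
    exact ⟨L, hL⟩
  choose L hL using hlim
  have hLadd : ∀ f g, L (f + g) = L f + L g := by
    intro f g
    refine tendsto_nhds_unique (hL (f + g)) (((hL f).add (hL g)).congr fun n => ?_)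
    simp only [a, map_add, ContinuousMap.add_apply, Finset.sum_add_distrib, mul_add]
  have hLsmul : ∀ (c : ℝ) g, L (c • g) = c • L g := by
    intro c g
    refine tendsto_nhds_unique (hL (c • g)) (((hL g).const_mul c).congr fun n => ?_)
    simp only [a, map_smul, ContinuousMap.smul_apply, smul_eq_mul, ← Finset.mul_sum]
    ring
  have hLpos : ∀ g, 0 ≤ g → 0 ≤ L g := by
    intro g hg
    refine ge_of_tendsto' (hL g) fun n => ?_
    exact mul_nonneg (by positivity) (Finset.sum_nonneg fun k _ => hpow k g hg z)
  have hL1 : L 1 = 1 := by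
    refine tendsto_nhds_unique (hL 1) (tendsto_const_nhds.congr fun n => ?_)
    have hn : (n + 1 : ℝ) ≠ 0 := by positivity
    simp [a, hpow1, hn]
  have hLP : ∀ g, L (P g) = L g := by
    intro g
    -- The difference of the two averages telescopes and is at most `2‖g‖ / (n + 1)`.
    have h0 : Tendsto (fun n => a (P g) n - a g n) U (𝓝 0) := by
      refine Tendsto.mono_left ?_ hU
      have hlim0 : Tendsto (fun n : ℕ => (2 * ‖g‖) * (1 / ((n : ℝ) + 1))) atTop (𝓝 0) := by
        simpa using tendsto_one_div_add_atTop_nhds_zero_nat.const_mul (2 * ‖g‖)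
      refine squeeze_zero_norm (fun n => ?_) hlim0
      have hn : (0 : ℝ) < n + 1 := by positivity
      have he : a (P g) n - a g n = (n + 1 : ℝ)⁻¹ * ((P ^ (n + 1)) g z - (P ^ 0) g z) := by
        simp only [a]
        rw [← mul_sub, ← Finset.sum_sub_distrib, ← Finset.sum_range_sub (fun k => (P ^ k) g z)]
        congr 1
      rw [he, Real.norm_eq_abs, abs_mul, abs_inv, abs_of_pos hn, mul_comm, one_div]
      refine mul_le_mul_of_nonneg_right ?_ (by positivity)
      have h1 := abs_sub ((P ^ (n + 1)) g z) ((P ^ 0) g z)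
      have h2 := hbound (n + 1) g
      have h3 := hbound 0 g
      linarith
    have := tendsto_nhds_unique h0 ((hL (P g)).sub (hL g))
    linarith
  let Λ : CompactlySupportedContinuousMap X ℝ →ₚ[ℝ] ℝ := PositiveLinearMap.mk₀
    { toFun := fun f => L f.1
      map_add' := fun f g => hLadd f.1 g.1
      map_smul' := fun c f => hLsmul c f.1 } (fun f hf => hLpos f.1 hf)
  have hΛ : ∀ g : C(X, ℝ), ∫ x, g x ∂(RealRMK.rieszMeasure Λ) = L g := fun g =>
    RealRMK.integral_rieszMeasure Λ (CompactlySupportedContinuousMap.continuousMapEquiv g)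
  refine ⟨RealRMK.rieszMeasure Λ, ?_, fun g => by rw [hΛ, hΛ, hLP], fun g hg => ?_⟩
  · have h1 := hΛ 1
    rw [hL1] at h1
    simp only [ContinuousMap.one_apply, integral_const, smul_eq_mul, mul_one] at h1
    refine ⟨?_⟩
    rw [Measure.real, ENNReal.toReal_eq_one_iff] at h1
    exact h1
  · rw [hΛ]
    refine tendsto_nhds_unique (hL g) (tendsto_const_nhds.congr fun n => ?_)
    simp [a, hg]

/-! ### Continuity of the flows -/

namespace SwitchedPDMP

namespace Model

variable {d : ℕ} {E : Type*} [Fintype E] (D : Model d E)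

theorem Phi_zero (i : E) (x : D.M) : D.Phi i 0 x = x := by
  obtain ⟨C, hC⟩ := D.bounded
  exact Subtype.ext (flow_spec (D.F i) (D.smooth i) (hC i) x).1

theorem continuous_Phi_time (i : E) (x : D.M) : Continuous fun t : ℝ≥0 => D.Phi i t x := by
  obtain ⟨C, hC⟩ := D.bounded
  have h : Continuous fun t : ℝ => flow (D.F i) t x := continuous_iff_continuousAt.2 fun t =>
    ((flow_spec (D.F i) (D.smooth i) (hC i) x).2 t).continuousAt
  exact Continuous.subtype_mk (h.comp NNReal.continuous_coe) _

/-- Grönwall: trajectories from `M` stay in `M`, hence in a closed ball on which the smooth field is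
Lipschitz. -/
theorem continuous_Phi_space (i : E) (t : ℝ≥0) : Continuous (D.Phi i t) := by
  obtain ⟨C, hC⟩ := D.bounded
  have hspec := fun x => flow_spec (D.F i) (D.smooth i) (hC i) x
  obtain ⟨R, hR⟩ := D.isCompact_M.isBounded.subset_closedBall 0
  obtain ⟨K, hK⟩ := (D.smooth i).contDiffOn.exists_lipschitzOnWith (by simp)
    (convex_closedBall 0 R) (isCompact_closedBall 0 R)
  have hcont : ∀ x, Continuous fun s : ℝ => flow (D.F i) s x := fun x =>
    continuous_iff_continuousAt.2 fun s => ((hspec x).2 s).continuousAt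
  have hmem : ∀ x ∈ D.M, ∀ s ∈ Ico (0 : ℝ) t, flow (D.F i) s x ∈ Metric.closedBall 0 R :=
    fun x hx s hs => hR (D.flow_mem i s hs.1 x hx)
  have hlip : LipschitzWith (Real.toNNReal (Real.exp (K * t))) (D.Phi i t) := by
    refine LipschitzWith.of_dist_le_mul fun x y => ?_
    have := dist_le_of_trajectories_ODE_of_mem (v := fun _ => D.F i) (a := 0) (b := t)
      (s := fun _ => Metric.closedBall 0 R) (K := K) (δ := dist x y)
      (f := fun s => flow (D.F i) s x) (g := fun s => flow (D.F i) s y) (fun _ _ => hK)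
      (hcont x).continuousOn (fun s _ => ((hspec x).2 s).hasDerivWithinAt) (hmem x x.2)
      (hcont y).continuousOn (fun s _ => ((hspec y).2 s).hasDerivWithinAt) (hmem y y.2)
      (by simp only [(hspec _).1]; exact le_rfl) t ⟨t.2, le_rfl⟩
    rw [Real.coe_toNNReal _ (Real.exp_pos _).le, mul_comm]
    rwa [sub_zero] at this
  exact hlip.continuous

/-! ### The jump matrix and the exponential clock -/

theorem Q_of_ne (x : D.M) {i j : E} (h : i ≠ j) : D.Q x i j = D.rate x i j / D.lam := by
  simp [Q, h]

theorem Q_self (x : D.M) (i : E) : D.Q x i i = 1 - ∑ k, D.rate x i k / D.lam := by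
  classical
  rw [← Finset.add_sum_erase _ _ (Finset.mem_univ i), D.rate_self]
  simp only [Q, if_true, zero_div, zero_add]

/-- This is where the strict bound on the total jump rates enters: the chain may always keep its
index. -/
theorem Q_self_pos (x : D.M) (i : E) : 0 < D.Q x i i := by
  rw [Q_self, ← Finset.sum_div, sub_pos, div_lt_one D.lam_pos]
  exact D.sum_rate_lt x i

theorem Q_nonneg (x : D.M) (i j : E) : 0 ≤ D.Q x i j := by
  rcases eq_or_ne i j with rfl | h
  · exact (D.Q_self_pos x i).le
  · rw [D.Q_of_ne x h]
    exact div_nonneg (D.rate_nonneg x i j h) D.lam_pos.le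

theorem Q_pos_of_rate_pos {x : D.M} {i j : E} (h : 0 < D.rate x i j) : 0 < D.Q x i j := by
  rw [D.Q_of_ne x (fun hij => by subst hij; rw [D.rate_self] at h; exact lt_irrefl _ h)]
  exact div_pos h D.lam_pos

theorem sum_Q (x : D.M) (i : E) : ∑ j, D.Q x i j = 1 := by
  classical
  rw [← Finset.add_sum_erase _ _ (Finset.mem_univ i),
    Finset.sum_congr rfl fun j hj => D.Q_of_ne x (Finset.ne_of_mem_erase hj).symm, Q_self,
    ← Finset.add_sum_erase _ _ (Finset.mem_univ i), D.rate_self]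
  ring

theorem continuous_Q (i j : E) : Continuous fun x => D.Q x i j := by
  rcases eq_or_ne i j with rfl | h
  · simp only [Q_self]
    exact continuous_const.sub (continuous_finsetSum _ fun k _ =>
      (D.rate_continuous i k).div_const _)
  · simp only [D.Q_of_ne _ h]
    exact (D.rate_continuous i j).div_const _

theorem jumpOp_nonneg {g : D.M × E → ℝ} (hg : ∀ z, 0 ≤ g z) (z : D.M × E) : 0 ≤ D.jumpOp g z :=
  Finset.sum_nonneg fun j _ => mul_nonneg (D.Q_nonneg _ _ j) (hg _)

theorem abs_jumpOp_le {g : D.M × E → ℝ} {C : ℝ} (hg : ∀ z, |g z| ≤ C) (z : D.M × E) :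
    |D.jumpOp g z| ≤ C := by
  calc |D.jumpOp g z| ≤ ∑ j, |D.Q z.1 z.2 j * g (z.1, j)| := Finset.abs_sum_le_sum_abs _ _
    _ ≤ ∑ j, D.Q z.1 z.2 j * C := Finset.sum_le_sum fun j _ => by
        rw [abs_mul, abs_of_nonneg (D.Q_nonneg _ _ _)]
        exact mul_le_mul_of_nonneg_left (hg _) (D.Q_nonneg _ _ _)
    _ = C := by rw [← Finset.sum_mul, sum_Q, one_mul]

theorem integrableOn_weight : IntegrableOn (fun t => D.lam * Real.exp (-D.lam * t)) (Ioi 0) :=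
  (exp_neg_integrableOn_Ioi 0 D.lam_pos).const_mul _

theorem integral_weight : ∫ t in Ioi (0 : ℝ), D.lam * Real.exp (-D.lam * t) = 1 := by
  rw [integral_const_mul, integral_exp_mul_Ioi (neg_lt_zero.2 D.lam_pos)]
  have := D.lam_pos.ne'
  simp [this]

/-- `P̃ g` on a positively invariant set depends only on the values of `g` there. -/
theorem transitionOp_congr {K : Set D.M} (hK : ∀ i t, ∀ x ∈ K, D.Phi i t x ∈ K)
    {f g : D.M × E → ℝ} (hfg : ∀ z : D.M × E, z.1 ∈ K → f z = g z) {z : D.M × E} (hz : z.1 ∈ K) :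
    D.transitionOp f z = D.transitionOp g z := by
  simp only [transitionOp, flowOp, jumpOp]
  congr! 5
  exact hfg _ (hK _ _ _ hz)

/-! ### Orbit closures and the accessible set -/

theorem composite_append_singleton (l : List (E × ℝ≥0)) (p : E × ℝ≥0) (x : D.M) :
    D.composite (l ++ [p]) x = D.Phi p.1 p.2 (D.composite l x) := by
  simp [composite]

theorem composite_mem {K : Set D.M} (hK : ∀ i t, ∀ x ∈ K, D.Phi i t x ∈ K) (l : List (E × ℝ≥0))
    {x : D.M} (hx : x ∈ K) : D.composite l x ∈ K := by
  induction l generalizing x with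
  | nil => exact hx
  | cons p l ih => exact ih (hK p.1 p.2 x hx)

/-- The positive orbit closure of `y`, as a subset of `M`. -/
def orbitClosure (y : D.M) : Set D.M := closure {x | ∃ l ≠ [], D.composite l y = x}

theorem mem_orbitClosure_iff {x y : D.M} :
    x ∈ D.orbitClosure y ↔ (x : EuclideanSpace ℝ (Fin d)) ∈ closure (D.orbit y) := by
  rw [orbitClosure, closure_subtype]
  congr! 2
  ext z
  constructor
  · rintro ⟨_, ⟨l, hl, rfl⟩, rfl⟩
    exact ⟨l, hl, rfl⟩
  · rintro ⟨l, hl, rfl⟩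
    exact ⟨_, ⟨l, hl, rfl⟩, rfl⟩

theorem orbitClosure_nonempty [Nonempty E] (y : D.M) : (D.orbitClosure y).Nonempty := by
  obtain ⟨i⟩ := ‹Nonempty E›
  exact ⟨_, subset_closure ⟨[(i, 0)], by simp, rfl⟩⟩

theorem Phi_mem_orbitClosure (y : D.M) (i : E) (t : ℝ≥0) (x : D.M) (hx : x ∈ D.orbitClosure y) :
    D.Phi i t x ∈ D.orbitClosure y := by
  refine MapsTo.closure ?_ (D.continuous_Phi_space i t) hx
  rintro _ ⟨l, -, rfl⟩
  exact ⟨l ++ [(i, t)], by simp, D.composite_append_singleton l (i, t) y⟩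

theorem orbitClosure_subset {K : Set D.M} (hKc : IsClosed K)
    (hK : ∀ i t, ∀ x ∈ K, D.Phi i t x ∈ K) {y : D.M} (hy : y ∈ K) : D.orbitClosure y ⊆ K :=
  closure_minimal (by rintro _ ⟨l, -, rfl⟩; exact D.composite_mem hK l hy) hKc

/-- The accessible set, as a subset of `M`. -/
def accessibleIn : Set D.M := {x | (x : EuclideanSpace ℝ (Fin d)) ∈ D.accessible}

theorem accessibleIn_eq : D.accessibleIn = ⋂ y, D.orbitClosure y := by
  ext x
  simp [accessibleIn, accessible, mem_orbitClosure_iff]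

theorem isClosed_accessibleIn : IsClosed D.accessibleIn := by
  rw [accessibleIn_eq]
  exact isClosed_iInter fun _ => isClosed_closure

theorem Phi_mem_accessibleIn (i : E) (t : ℝ≥0) (x : D.M) (hx : x ∈ D.accessibleIn) :
    D.Phi i t x ∈ D.accessibleIn := by
  rw [accessibleIn_eq, mem_iInter] at hx ⊢
  exact fun y => D.Phi_mem_orbitClosure y i t x (hx y)

/-- For any `y ∈ K`, the closure of the orbit of `y` contains `Γ` and stays in `K`. Every lower
bound on a support comes from this minimality. -/
theorem accessibleIn_subset {K : Set D.M} (hKc : IsClosed K)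
    (hK : ∀ i t, ∀ x ∈ K, D.Phi i t x ∈ K) (hne : K.Nonempty) : D.accessibleIn ⊆ K := by
  obtain ⟨y, hy⟩ := hne
  rw [accessibleIn_eq]
  exact (iInter_subset _ y).trans (D.orbitClosure_subset hKc hK hy)

theorem accessibleProd_eq : D.accessibleProd = Prod.fst ⁻¹' D.accessibleIn := rfl

/-! ### The transition operator on continuous functions -/

variable [TopologicalSpace E]

instance : CompactSpace D.M := isCompact_iff_compactSpace.1 D.isCompact_M

theorem continuous_flowOp_time (z : D.M × E) {g : D.M × E → ℝ} (hg : Continuous g) :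
    Continuous fun t => D.flowOp t g z :=
  hg.comp (Continuous.prodMk (D.continuous_Phi_time z.2 z.1) continuous_const)

theorem abs_integrand_le (g : C(D.M × E, ℝ)) (z : D.M × E) (t : ℝ) :
    ‖D.flowOp t.toNNReal (D.jumpOp g) z * (D.lam * Real.exp (-D.lam * t))‖ ≤
      ‖g‖ * (D.lam * Real.exp (-D.lam * t)) := by
  have hw : 0 ≤ D.lam * Real.exp (-D.lam * t) := mul_nonneg D.lam_pos.le (Real.exp_pos _).le
  rw [Real.norm_eq_abs, abs_mul, abs_of_nonneg hw]
  exact mul_le_mul_of_nonneg_right (D.abs_jumpOp_le (fun z => g.norm_coe_le_norm z) _) hw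

variable [DiscreteTopology E]

theorem continuous_jumpOp {g : D.M × E → ℝ} (hg : Continuous g) : Continuous (D.jumpOp g) := by
  rw [continuous_prod_of_discrete_right]
  intro i
  exact continuous_finsetSum _ fun j _ =>
    (D.continuous_Q i j).mul (hg.comp (Continuous.prodMk continuous_id continuous_const))

theorem continuous_flowOp_space (t : ℝ≥0) {g : D.M × E → ℝ} (hg : Continuous g) :
    Continuous (D.flowOp t g) := by
  rw [continuous_prod_of_discrete_right]
  intro i
  exact hg.comp (Continuous.prodMk (D.continuous_Phi_space i t) continuous_const)

theorem continuous_integrand (z : D.M × E) {g : D.M × E → ℝ} (hg : Continuous g) :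
    Continuous fun t : ℝ =>
      D.flowOp t.toNNReal (D.jumpOp g) z * (D.lam * Real.exp (-D.lam * t)) :=
  ((D.continuous_flowOp_time z (D.continuous_jumpOp hg)).comp continuous_real_toNNReal).mul
    (by fun_prop)

theorem integrableOn_integrand (g : C(D.M × E, ℝ)) (z : D.M × E) :
    IntegrableOn (fun t : ℝ => D.flowOp t.toNNReal (D.jumpOp g) z *
      (D.lam * Real.exp (-D.lam * t))) (Ioi 0) :=
  (D.integrableOn_weight.const_mul ‖g‖).mono'
    (D.continuous_integrand z g.continuous).aestronglyMeasurable
    (Eventually.of_forall fun t => D.abs_integrand_le g z t)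

/-- The Feller property of the embedded chain. -/
theorem continuous_transitionOp (g : C(D.M × E, ℝ)) : Continuous (D.transitionOp g) :=
  continuous_of_dominated
    (fun z => (D.continuous_integrand z g.continuous).aestronglyMeasurable)
    (fun z => Eventually.of_forall fun t => D.abs_integrand_le g z t)
    (D.integrableOn_weight.const_mul ‖g‖)
    (Eventually.of_forall fun _ =>
      (D.continuous_flowOp_space _ (D.continuous_jumpOp g.continuous)).mul continuous_const)

/-- The transition operator as a linear map on `C(M × E, ℝ)`. -/
noncomputable def transitionMap : C(D.M × E, ℝ) →ₗ[ℝ] C(D.M × E, ℝ) where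
  toFun g := ⟨D.transitionOp g, D.continuous_transitionOp g⟩
  map_add' f g := by
    ext z
    change D.transitionOp (f + g) z = D.transitionOp f z + D.transitionOp g z
    simp only [transitionOp]
    rw [← integral_add (D.integrableOn_integrand f z) (D.integrableOn_integrand g z)]
    refine integral_congr_ae (Eventually.of_forall fun t => ?_)
    simp only [flowOp, jumpOp, Pi.add_apply, mul_add, Finset.sum_add_distrib, add_mul]
  map_smul' c g := by
    ext z
    change D.transitionOp (c • g) z = c * D.transitionOp g z
    simp only [transitionOp]
    rw [← integral_const_mul]
    refine integral_congr_ae (Eventually.of_forall fun t => ?_)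
    simp only [flowOp, jumpOp, Pi.smul_apply, smul_eq_mul, ← mul_assoc, Finset.mul_sum]
    congr! 3
    ring_nf

@[simp]
theorem transitionMap_apply (g : C(D.M × E, ℝ)) (z : D.M × E) :
    D.transitionMap g z = D.transitionOp g z := rfl

theorem transitionMap_nonneg (g : C(D.M × E, ℝ)) (hg : 0 ≤ g) : 0 ≤ D.transitionMap g := fun _ =>
  setIntegral_nonneg measurableSet_Ioi fun _ _ =>
    mul_nonneg (D.jumpOp_nonneg hg _) (mul_nonneg D.lam_pos.le (Real.exp_pos _).le)

theorem transitionMap_one : D.transitionMap 1 = 1 := by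
  ext z
  simpa [transitionOp, flowOp, jumpOp, sum_Q] using D.integral_weight

/-- The integrand is continuous and nonnegative, so it vanishes at every `t ≥ 0` and not merely
almost everywhere; then each term of the sum over the indices vanishes. -/
theorem eq_zero_of_transitionOp_eq_zero {g : C(D.M × E, ℝ)} (hg : ∀ z, 0 ≤ g z) {x : D.M} {i : E}
    (h : D.transitionOp g (x, i) = 0) (t : ℝ≥0) {j : E} (hQ : 0 < D.Q (D.Phi i t x) i j) :
    g (D.Phi i t x, j) = 0 := by
  have hw : ∀ s, 0 < D.lam * Real.exp (-D.lam * s) := fun s => mul_pos D.lam_pos (Real.exp_pos _)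
  have h1 := eq_zero_of_integral_eq_zero_of_mem_support
    (D.continuous_integrand (x, i) g.continuous)
    (fun s => mul_nonneg (D.jumpOp_nonneg hg _) (hw s).le) (D.integrableOn_integrand g (x, i)) h
    (mem_support_restrict_Ioi t.2)
  have h2 := (mul_eq_zero.1 h1).resolve_right (hw _).ne'
  simp only [flowOp, jumpOp, NNReal.val_eq_coe, Real.toNNReal_coe] at h2
  have h3 := (Finset.sum_eq_zero_iff_of_nonneg fun k _ =>
    mul_nonneg (D.Q_nonneg _ i k) (hg _)).1 h2 j (Finset.mem_univ j)
  exact (mul_eq_zero.1 h3).resolve_left hQ.ne'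

/-! ### Supports of invariant measures -/

variable [MeasurableSpace E] [BorelSpace E]

/-- The support of an invariant measure is stable under the transitions of the chain. -/
theorem mem_support_of_transition {μ : Measure (D.M × E)} [IsFiniteMeasure μ]
    (hμ : ∀ g : C(D.M × E, ℝ), ∫ z, D.transitionOp g z ∂μ = ∫ z, g z ∂μ) {x : D.M} {i : E}
    (hx : (x, i) ∈ μ.support) (t : ℝ≥0) {j : E} (hQ : 0 < D.Q (D.Phi i t x) i j) :
    (D.Phi i t x, j) ∈ μ.support := by
  by_contra hj
  obtain ⟨g, h0, h1, hg⟩ :=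
    exists_continuousMap_eqOn_zero_of_notMem (Measure.isClosed_support (μ := μ)) hj
  have hint : ∫ z, g z ∂μ = 0 := integral_eq_zero_of_ae
    (Filter.mem_of_superset Measure.support_mem_ae fun z hz => h0 z hz)
  have hP : D.transitionOp g (x, i) = 0 :=
    eq_zero_of_integral_eq_zero_of_mem_support (D.continuous_transitionOp g)
      (D.transitionMap_nonneg g hg)
      ((D.transitionMap g).continuous.integrable_of_hasCompactSupport
        (HasCompactSupport.of_compactSpace _)) ((hμ g).trans hint) hx
  have := D.eq_zero_of_transitionOp_eq_zero hg hP t hQ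
  rw [h1] at this
  exact one_ne_zero this

/-- Follow a path of positive rates at `x`, each jump being made after flow time 0. -/
theorem mem_support_of_mem_support {μ : Measure (D.M × E)} [IsFiniteMeasure μ]
    (hμ : ∀ g : C(D.M × E, ℝ), ∫ z, D.transitionOp g z ∂μ = ∫ z, g z ∂μ) {x : D.M} {i : E}
    (hx : (x, i) ∈ μ.support) (j : E) : (x, j) ∈ μ.support := by
  induction D.rate_irreducible x i j with
  | refl => exact hx
  | tail _ hbc ih =>
    have h := D.mem_support_of_transition hμ ih 0
      (by rw [D.Phi_zero]; exact D.Q_pos_of_rate_pos hbc)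
    rwa [D.Phi_zero] at h

/-- The slice of the support at index `j` is closed, nonempty and positively invariant, so it
contains `Γ`. Finite nonzero measures are allowed because the result is later applied to a
restriction of an invariant probability. -/
theorem accessibleProd_subset_support {μ : Measure (D.M × E)} [IsFiniteMeasure μ]
    (hμ : ∀ g : C(D.M × E, ℝ), ∫ z, D.transitionOp g z ∂μ = ∫ z, g z ∂μ) (h0 : μ ≠ 0) :
    D.accessibleProd ⊆ μ.support := by
  obtain ⟨⟨x, i⟩, hx⟩ := Measure.nonempty_support h0
  rintro ⟨p, j⟩ hp
  refine D.accessibleIn_subset (K := (fun y => (y, j)) ⁻¹' μ.support)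
    (Measure.isClosed_support.preimage (by fun_prop)) (fun k t y hy => ?_)
    ⟨x, D.mem_support_of_mem_support hμ hx j⟩ hp
  exact D.mem_support_of_mem_support hμ (D.mem_support_of_transition hμ
    (D.mem_support_of_mem_support hμ hy k) t (D.Q_self_pos _ k)) j

/-- A function vanishing on `K × E` has all its iterates vanishing there, so the Krylov–Bogoliubov
measure started over `K` integrates it to zero; Urysohn functions then confine the support. -/
theorem exists_isInvariant_support_subset [Nonempty E] {K : Set D.M} (hKc : IsClosed K)
    (hK : ∀ i t, ∀ x ∈ K, D.Phi i t x ∈ K) (hne : K.Nonempty) :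
    ∃ μ : Measure (D.M × E), D.IsInvariant μ ∧ μ.support ⊆ Prod.fst ⁻¹' K := by
  obtain ⟨y, hy⟩ := hne
  obtain ⟨i⟩ := ‹Nonempty E›
  obtain ⟨μ, hprob, hinv, hzero⟩ := exists_invariant_probabilityMeasure D.transitionMap
    D.transitionMap_nonneg D.transitionMap_one (y, i)
  refine ⟨μ, ⟨hprob, hinv⟩, fun z hz => ?_⟩
  by_contra hzK
  obtain ⟨g, h0, h1, hg⟩ :=
    exists_continuousMap_eqOn_zero_of_notMem (hKc.preimage continuous_fst) hzK
  have hpow : ∀ n : ℕ, ∀ w : D.M × E, w.1 ∈ K → (D.transitionMap ^ n) g w = 0 := by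
    intro n
    induction n with
    | zero => exact fun w hw => h0 w hw
    | succ n ih =>
      intro w hw
      rw [pow_succ', Module.End.mul_apply, transitionMap_apply,
        D.transitionOp_congr hK (g := fun _ => 0) ih hw]
      simp [transitionOp, flowOp, jumpOp]
  have h := eq_zero_of_integral_eq_zero_of_mem_support g.continuous hg
    (g.continuous.integrable_of_hasCompactSupport (HasCompactSupport.of_compactSpace _))
    (hzero g fun n => hpow n (y, i) hy) hz
  rw [h1] at h
  exact one_ne_zero h

/-! ### Restriction to closed positively invariant sets -/

/-- Invariance is only known against continuous functions, so `g · 1_K` is approximated by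
continuous `θ n ≥ 0` equal to `g` over `K`. There `P̃ (θ n) = P̃ g`, and discarding the integral of
`P̃ (θ n)` off `K` gives the inequality. -/
theorem setIntegral_transitionOp_le {μ : Measure (D.M × E)} [IsFiniteMeasure μ]
    (hμ : ∀ g : C(D.M × E, ℝ), ∫ z, D.transitionOp g z ∂μ = ∫ z, g z ∂μ) {K : Set D.M}
    (hKc : IsClosed K) (hK : ∀ i t, ∀ x ∈ K, D.Phi i t x ∈ K) (g : C(D.M × E, ℝ)) (hg : 0 ≤ g) :
    ∫ z in Prod.fst ⁻¹' K, D.transitionOp g z ∂μ ≤ ∫ z in Prod.fst ⁻¹' K, g z ∂μ := by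
  have hKm : MeasurableSet (Prod.fst ⁻¹' K : Set (D.M × E)) :=
    (hKc.preimage continuous_fst).measurableSet
  have hint : ∀ f : C(D.M × E, ℝ), Integrable f μ := fun f =>
    f.continuous.integrable_of_hasCompactSupport (HasCompactSupport.of_compactSpace _)
  let θ : ℕ → C(D.M × E, ℝ) := fun n =>
    ⟨fun z => g z * (hKc.apprSeq n z.1 : ℝ), g.continuous.mul
      (NNReal.continuous_coe.comp ((hKc.apprSeq n).continuous.comp continuous_fst))⟩
  have hθ0 : ∀ n, 0 ≤ θ n := fun n z => mul_nonneg (hg z) (hKc.apprSeq n z.1).2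
  have hθK : ∀ n (z : D.M × E), z.1 ∈ K → θ n z = g z := fun n z hz => by
    simp [θ, HasOuterApproxClosed.apprSeq_apply_eq_one hKc n hz]
  have hle : ∀ n, ∫ z in Prod.fst ⁻¹' K, D.transitionOp g z ∂μ ≤ ∫ z, θ n z ∂μ := by
    intro n
    rw [← hμ (θ n), setIntegral_congr_fun hKm fun z (hz : z.1 ∈ K) =>
      (D.transitionOp_congr hK (hθK n) hz).symm]
    exact setIntegral_le_integral (hint (D.transitionMap (θ n)))
      (Eventually.of_forall (D.transitionMap_nonneg _ (hθ0 n)))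
  have hlim : Tendsto (fun n => ∫ z, θ n z ∂μ) atTop
      (𝓝 (∫ z, (Prod.fst ⁻¹' K : Set (D.M × E)).indicator g z ∂μ)) := by
    refine tendsto_integral_of_dominated_convergence (fun z => ‖g z‖)
      (fun n => (θ n).continuous.aestronglyMeasurable) (hint g).norm
      (fun n => Eventually.of_forall fun z => ?_) (Eventually.of_forall fun z => ?_)
    · change ‖g z * (hKc.apprSeq n z.1 : ℝ)‖ ≤ ‖g z‖
      rw [norm_mul]
      refine mul_le_of_le_one_right (norm_nonneg _) ?_
      simpa using HasOuterApproxClosed.apprSeq_apply_le_one hKc n z.1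
    · have h1 := (tendsto_pi_nhds.1 (HasOuterApproxClosed.tendsto_apprSeq hKc)) z.1
      have h2 := ((NNReal.continuous_coe.tendsto _).comp h1).const_mul (g z)
      have he : g z * ((K.indicator (fun _ => (1 : ℝ≥0)) z.1 : ℝ≥0) : ℝ) =
          (Prod.fst ⁻¹' K : Set (D.M × E)).indicator g z := by
        by_cases hz : z.1 ∈ K <;> simp [indicator, hz]
      rwa [he] at h2
  rw [integral_indicator hKm] at hlim
  exact ge_of_tendsto' hlim hle

/-- The restriction of an invariant measure to a closed positively invariant set is invariant. -/
theorem setIntegral_transitionOp {μ : Measure (D.M × E)} [IsFiniteMeasure μ]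
    (hμ : ∀ g : C(D.M × E, ℝ), ∫ z, D.transitionOp g z ∂μ = ∫ z, g z ∂μ) {K : Set D.M}
    (hKc : IsClosed K) (hK : ∀ i t, ∀ x ∈ K, D.Phi i t x ∈ K) (g : C(D.M × E, ℝ)) :
    ∫ z in Prod.fst ⁻¹' K, D.transitionOp g z ∂μ = ∫ z in Prod.fst ⁻¹' K, g z ∂μ := by
  have hint : ∀ f : C(D.M × E, ℝ), IntegrableOn f (Prod.fst ⁻¹' K) μ := fun f =>
    (f.continuous.integrable_of_hasCompactSupport (HasCompactSupport.of_compactSpace _)).integrableOn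
  have key : ∀ f : C(D.M × E, ℝ), ∫ z in Prod.fst ⁻¹' K, D.transitionOp f z ∂μ ≤
      ∫ z in Prod.fst ⁻¹' K, f z ∂μ := by
    intro f
    -- Adding the constant `‖f‖` makes the function nonnegative; since `P̃ 1 = 1`, the constant
    -- cancels afterwards.
    have h := D.setIntegral_transitionOp_le hμ hKc hK (f + ‖f‖ • 1) fun z => by
      have := (abs_le.1 (f.norm_coe_le_norm z)).1
      change 0 ≤ f z + ‖f‖ * 1
      linarith
    have hP : ∀ z, D.transitionOp (f + ‖f‖ • 1 : C(D.M × E, ℝ)) z = D.transitionOp f z + ‖f‖ := by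
      intro z
      rw [← transitionMap_apply, map_add, map_smul, transitionMap_one]
      simp
    simp only [hP, ContinuousMap.add_apply, ContinuousMap.smul_apply,
        ContinuousMap.one_apply, smul_eq_mul, mul_one] at h
    have hf : IntegrableOn (D.transitionOp f) (Prod.fst ⁻¹' K) μ := hint (D.transitionMap f)
    rw [integral_add hf (integrable_const _), integral_add (hint f) (integrable_const _)] at h
    exact le_of_add_le_add_right h
  refine le_antisymm (key g) ?_
  have h := key (-g)
  have hP : ∀ z, D.transitionOp (-g : C(D.M × E, ℝ)) z = -D.transitionOp g z := by
    intro z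
    rw [← transitionMap_apply, map_neg]
    rfl
  simp only [hP, ContinuousMap.neg_apply, integral_neg] at h
  exact neg_le_neg_iff.1 h

/-- The restriction of `μ` to the complement of `Γ × E` is a difference of invariant measures. Were
it nonzero, its support would contain points over the interior of `Γ`, an open set to which it gives
no mass. -/
theorem measure_compl_accessibleProd_eq_zero (hne : (interior D.accessible).Nonempty)
    {μ : Measure (D.M × E)} [IsFiniteMeasure μ]
    (hμ : ∀ g : C(D.M × E, ℝ), ∫ z, D.transitionOp g z ∂μ = ∫ z, g z ∂μ) :
    μ D.accessibleProdᶜ = 0 := by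
  obtain ⟨p, hp⟩ := hne
  have hpΓ := interior_subset hp
  have hm : MeasurableSet D.accessibleProd :=
    (D.isClosed_accessibleIn.preimage continuous_fst).measurableSet
  by_contra h0
  obtain ⟨⟨-, i⟩, -⟩ := nonempty_of_measure_ne_zero h0
  have hsub := D.accessibleProd_subset_support (μ := μ.restrict D.accessibleProdᶜ) (fun g => by
    have hint : ∀ f : C(D.M × E, ℝ), Integrable f μ := fun f =>
      f.continuous.integrable_of_hasCompactSupport (HasCompactSupport.of_compactSpace _)
    have hg : Integrable (D.transitionOp g) μ := hint (D.transitionMap g)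
    rw [setIntegral_compl hm hg, setIntegral_compl hm (hint g)]
    exact congrArg₂ _ (hμ g)
      (D.setIntegral_transitionOp hμ D.isClosed_accessibleIn D.Phi_mem_accessibleIn g))
    (by rwa [Ne, Measure.restrict_eq_zero])
  have hmem := hsub (show ((⟨p, hpΓ.1⟩, i) : D.M × E) ∈ D.accessibleProd from hpΓ)
  rw [Measure.mem_support_iff_forall] at hmem
  have hU : IsOpen {z : D.M × E | (z.1 : EuclideanSpace ℝ (Fin d)) ∈ interior D.accessible} :=
    isOpen_interior.preimage (continuous_subtype_val.comp continuous_fst)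
  refine (hmem _ (hU.mem_nhds hp)).ne' ?_
  rw [Measure.restrict_apply hU.measurableSet]
  exact measure_mono_null (fun z hz => hz.2 (interior_subset (s := D.accessible) hz.1)) measure_empty

end Model

end SwitchedPDMP

theorem mainTheorem7 {d : ℕ} {E : Type*} [Fintype E] [TopologicalSpace E] [DiscreteTopology E]
    [MeasurableSpace E] [BorelSpace E] (D : SwitchedPDMP.Model d E) :
    (D.accessible.Nonempty →
      (∀ μ : Measure (D.M × E), D.IsInvariant μ → D.accessibleProd ⊆ μ.support) ∧
      ∃ μ : Measure (D.M × E), D.IsInvariant μ ∧ μ.support = D.accessibleProd) ∧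
    ((interior D.accessible).Nonempty →
      ∀ μ : Measure (D.M × E), D.IsInvariant μ → μ.support = D.accessibleProd) ∧
    (D.IsStable →
      ∀ π : Measure (D.M × E), D.IsInvariant π → π.support = D.accessibleProd) := by
  have hsub : ∀ μ : Measure (D.M × E), D.IsInvariant μ → D.accessibleProd ⊆ μ.support := by
    intro μ hμ
    have := hμ.1
    exact D.accessibleProd_subset_support hμ.2 (IsProbabilityMeasure.ne_zero μ)
  refine ⟨fun hne => ⟨hsub, ?_⟩, fun hne μ hμ => ?_, fun hst π hπ => ?_⟩
  · obtain ⟨p, hpM, hp⟩ := hne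
    -- Orbits use only nonempty words, so an accessible point forces an index to exist.
    have hE : Nonempty E := by
      obtain ⟨_, l, hl, -⟩ := closure_nonempty_iff.1 ⟨p, mem_iInter.1 hp ⟨p, hpM⟩⟩
      obtain ⟨q, -⟩ := List.exists_mem_of_ne_nil l hl
      exact ⟨q.1⟩
    obtain ⟨μ, hμ, hμs⟩ := D.exists_isInvariant_support_subset D.isClosed_accessibleIn
      D.Phi_mem_accessibleIn ⟨⟨p, hpM⟩, hpM, hp⟩
    exact ⟨μ, hμ, hμs.antisymm (hsub μ hμ)⟩
  · have := hμ.1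
    exact (Measure.support_subset_of_isClosed (D.isClosed_accessibleIn.preimage continuous_fst)
      (D.measure_compl_accessibleProd_eq_zero hne hμ.2)).antisymm (hsub μ hμ)
  · refine Subset.antisymm (fun z hz => ?_) (hsub π hπ)
    have hE : Nonempty E := ⟨z.2⟩
    rw [D.accessibleProd_eq, D.accessibleIn_eq, mem_preimage, mem_iInter]
    intro y
    -- By uniqueness this measure is `π`, whatever the choice of `y`.
    obtain ⟨μ, hμ, hμs⟩ := D.exists_isInvariant_support_subset (K := D.orbitClosure y)
      isClosed_closure (D.Phi_mem_orbitClosure y) (D.orbitClosure_nonempty y)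
    rw [hst.unique hπ hμ] at hz
    exact hμs hz
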